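/- Let modal formulas be built from countably many propositional letters by $\bot$, $\to$ and boxes $\Box_1,\dots,\Box_N$ (with the other connectives and $\Diamond_i=\neg\Box_i\neg$ as abbreviations). A normal modal logic is a set of formulas that contains all classical tautologies and all $\Box_i(p\to q)\to(\Box_i p\to\Box_i q)$ and is closed under substitution, modus ponens and necessitation. Let $\mathsf{K}_N$ be the smallest normal modal logic with $N$ boxes, $\mathsf K=\mathsf K_1$, and let $\Lambda+\Gamma$ be the smallest normal modal logic containing $\Lambda\cup\Gamma$. The fusion of unimodal logics $\Lambda_1,\Lambda_2$ is the bimodal logic $\Lambda_1\ast\Lambda_2=\mathsf{K}_2+\Lambda_1'+\Lambda_2'$, where $\Lambda_i'$ is $\Lambda_i$ with every $\Box$ replaced by $\Box_i$. Put $\mathsf{S4}=\mathsf{K}+(\Box p\to p)+(\Box p\to\Box\Box p)$, $\mathsf{S4.1}=\mathsf{S4}+(\Box\Diamond p\to\Diamond\Box p)$, and $$\mathsf{L}=\mathsf{S4.1}\ast\mathsf{S4}+\Diamond_1\Box_2(\Diamond_1 p\to\Box_1 p).$$ Theorem. The logic $\mathsf{L}$ is finitely axiomatizable (that is, $\mathsf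 L=\mathsf K_2+\Gamma$ for some finite set $\Gamma$ of formulas), it has the finite model property (that is, $\mathsf{L}$ is the set of all formulas valid in every frame of some class of finite Kripke frames $(W,R_1,R_2)$, $W\neq\varnothing$), and it is decidable (that is, there is an algorithm that decides whether a given bimodal formula belongs to $\mathsf{L}$). -/

import Mathlib

namespace Modal

universe u

/-- Modal formulas with `N` boxes over the countably infinite set of letters `ℕ`. -/
inductive Formula (N : ℕ) : Type
  | var : ℕ → Formula N
  | bot : Formula N
  | imp : Formula N → Formula N → Formula N
  | box : Fin N → Formula N → Formula N

namespace Formula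

variable {N : ℕ}

/-- Negation, as the abbreviation `A → ⊥`. -/
def neg (A : Formula N) : Formula N := imp A bot

/-- The diamond, as the abbreviation `¬ □ᵢ ¬ A`. -/
def dia (i : Fin N) (A : Formula N) : Formula N := neg (box i (neg A))

/-- Uniform substitution of formulas for letters. -/
def subst (σ : ℕ → Formula N) : Formula N → Formula N
  | var p => σ p
  | bot => bot
  | imp A B => imp (A.subst σ) (B.subst σ)
  | box i A => box i (A.subst σ)

/-- Classical truth value under an assignment `v` of truth values to the letters and to the boxed
formulas (which are treated as atoms). -/
def classicalTruth (v : Formula N → Prop) : Formula N → Prop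
  | var p => v (var p)
  | bot => False
  | imp A B => A.classicalTruth v → B.classicalTruth v
  | box i A => v (box i A)

/-- Classical tautologies, including their modal instances. -/
def IsTautology (A : Formula N) : Prop := ∀ v : Formula N → Prop, A.classicalTruth v

/-- Replace the only box of a unimodal formula by `□ᵢ`. -/
def relabel (i : Fin N) : Formula 1 → Formula N
  | var p => var p
  | bot => bot
  | imp A B => imp (A.relabel i) (B.relabel i)
  | box _ A => box i (A.relabel i)

/-- A Gödel numbering of the modal formulas. -/
def code : Formula N → ℕ
  | bot => 0
  | var p => 3 * p + 1
  | imp A B => 3 * Nat.pair A.code B.code + 2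
  | box i A => 3 * (N * A.code + i) + 3

theorem code_injective : Function.Injective (code : Formula N → ℕ) := by
  intro A
  induction A with
  | var p =>
    intro B h
    cases B <;> simp only [code] at h
    · congr 1; omega
    all_goals omega
  | bot =>
    intro B h
    cases B <;> simp only [code] at h
    · omega
    · rfl
    all_goals omega
  | imp A₁ A₂ ih₁ ih₂ =>
    intro B h
    cases B <;> simp only [code] at h
    · omega
    · omega
    · have h2 := Nat.pair_eq_pair.1 (Nat.eq_of_mul_eq_mul_left (show 0 < 3 by norm_num)
        (Nat.add_right_cancel h))
      rw [ih₁ h2.1, ih₂ h2.2]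
    · omega
  | box i A ih =>
    intro B h
    cases B with
    | var p => simp only [code] at h; omega
    | bot => simp only [code] at h; omega
    | imp B₁ B₂ => simp only [code] at h; omega
    | box j B =>
      simp only [code] at h
      have h2 : N * A.code + (i : ℕ) = N * B.code + (j : ℕ) := by omega
      have hN : 0 < N := i.pos
      have hd := congrArg (· / N) h2
      have hm := congrArg (· % N) h2
      simp only [Nat.mul_add_div hN, Nat.div_eq_of_lt i.isLt, Nat.div_eq_of_lt j.isLt,
        Nat.mul_add_mod, Nat.mod_eq_of_lt i.isLt, Nat.mod_eq_of_lt j.isLt, add_zero] at hd hm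
      rw [ih hd, Fin.ext hm]

end Formula

open Formula

/-- Normal modal logics. -/
structure IsNormalLogic {N : ℕ} (L : Set (Formula N)) : Prop where
  taut : ∀ A : Formula N, A.IsTautology → A ∈ L
  normality : ∀ i : Fin N,
    imp (box i (imp (var 0) (var 1))) (imp (box i (var 0)) (box i (var 1))) ∈ L
  subst : ∀ (σ : ℕ → Formula N) (A : Formula N), A ∈ L → A.subst σ ∈ L
  mp : ∀ A B : Formula N, A ∈ L → imp A B ∈ L → B ∈ L
  nec : ∀ (i : Fin N) (A : Formula N), A ∈ L → box i A ∈ L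

/-- The smallest normal modal logic with `N` modalities. -/
def logicK (N : ℕ) : Set (Formula N) := ⋂₀ {L | IsNormalLogic L}

/-- `L + Γ`: the smallest normal modal logic that contains `L` and `Γ`. -/
def addAxioms {N : ℕ} (L Γ : Set (Formula N)) : Set (Formula N) :=
  ⋂₀ {L' | IsNormalLogic L' ∧ L ⊆ L' ∧ Γ ⊆ L'}

/-- The fusion of two unimodal logics. -/
def fusion (L₁ L₂ : Set (Formula 1)) : Set (Formula 2) :=
  addAxioms (addAxioms (logicK 2) (relabel 0 '' L₁)) (relabel 1 '' L₂)

/-- `S4 = K + □p → p + □p → □□p`. -/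
def logicS4 : Set (Formula 1) :=
  addAxioms (addAxioms (logicK 1) {imp (box 0 (var 0)) (var 0)})
    {imp (box 0 (var 0)) (box 0 (box 0 (var 0)))}

/-- `S4.1 = S4 + □◇p → ◇□p`. -/
def logicS41 : Set (Formula 1) :=
  addAxioms logicS4 {imp (box 0 (dia 0 (var 0))) (dia 0 (box 0 (var 0)))}

/-- `L = S4.1 ∗ S4 + ◇₁□₂(◇₁p → □₁p)`; the indices `1, 2` of the modalities are `0, 1 : Fin 2`. -/
def logicL : Set (Formula 2) :=
  addAxioms (fusion logicS41 logicS4)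
    {dia 0 (box 1 (imp (dia 0 (var 0)) (box 0 (var 0))))}

/-- Kripke `N`-frames. -/
structure KripkeFrame (N : ℕ) where
  World : Type u
  nonempty : Nonempty World
  R : Fin N → World → World → Prop

/-- Truth of a formula at a point of the Kripke model `(F, V)`. -/
def KripkeFrame.Sat {N : ℕ} (F : KripkeFrame.{u} N) (V : ℕ → Set F.World) :
    F.World → Formula N → Prop
  | x, var p => x ∈ V p
  | _, bot => False
  | x, imp A B => F.Sat V x A → F.Sat V x B
  | x, box i A => ∀ y, F.R i x y → F.Sat V y A

/-- Validity of a formula in a Kripke frame. -/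
def KripkeFrame.Valid {N : ℕ} (F : KripkeFrame.{u} N) (A : Formula N) : Prop :=
  ∀ (V : ℕ → Set F.World) (x : F.World), F.Sat V x A

/-- The logic of a class of Kripke frames. -/
def logicOf {N : ℕ} (C : Set (KripkeFrame.{u} N)) : Set (Formula N) :=
  {A | ∀ F ∈ C, F.Valid A}

/-- Finite model property: being the logic of a class of finite frames. (Up to isomorphism, every
finite frame lives in the lowest universe.) -/
def HasFiniteModelProperty {N : ℕ} (L : Set (Formula N)) : Prop :=
  ∃ C : Set (KripkeFrame.{0} N), (∀ F ∈ C, Finite F.World) ∧ L = logicOf C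

/-- Finite axiomatizability (over the smallest normal modal logic). -/
def IsFinitelyAxiomatizable {N : ℕ} (L : Set (Formula N)) : Prop :=
  ∃ Γ : Set (Formula N), Γ.Finite ∧ L = addAxioms (logicK N) Γ

/-- Decidability: the set of Gödel numbers of the members of `L` is recursive. -/
def IsDecidable {N : ℕ} (L : Set (Formula N)) : Prop :=
  ComputablePred (fun n : ℕ => ∃ A ∈ L, A.code = n)

end Modal

namespace Modal

open Formula

/-! ### Closure properties of normal logics and relabelling of boxes. -/

section NormalLogics

variable {N : ℕ}

/-! Finite axiomatizability holds because the two unimodal logics are finitely axiomatized and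
relabelling can be pulled back along minimality. The other two claims rest on `notMem_logicL_iff`:
nonmembership means refutation in a finite model whose points are types, that is, truth patterns on
the formulas of code at most `n`.

Soundness (`KripkeFrame.logicL_subset_valid`): it suffices that both relations are preorders and
every point has an R₁-successor `y` all of whose R₂-successors R₁-see only themselves.

Completeness (`refutable_of_notMem`) filtrates the canonical structure. Call `A` settled if ◇₁A →
□₁A. The S4.1 axiom lets formulas be settled one after another along R₁. Doing this for the formulas
□₂(settled A) and then using the extra axiom, every theory R₁-sees a final one, where □₂(settled A)
holds for all relevant `A`. From a final theory, R₁-steps preserve the type and R₂-steps preserve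
finality. So the filtered relations can be cut down at the types of final theories, and the finite
frame meets the soundness condition.

The sizes of these models are bounded in terms of `n`, so refutability is primitive recursive. -/

theorem isNormalLogic_sInter {S : Set (Set (Formula N))} (hS : ∀ L ∈ S, IsNormalLogic L) :
    IsNormalLogic (⋂₀ S) where
  taut A hA L hL := (hS L hL).taut A hA
  normality i L hL := (hS L hL).normality i
  subst σ A hA L hL := (hS L hL).subst σ A (hA L hL)
  mp A B hA hAB L hL := (hS L hL).mp A B (hA L hL) (hAB L hL)
  nec i A hA L hL := (hS L hL).nec i A (hA L hL)

theorem logicK_subset {L : Set (Formula N)} (hL : IsNormalLogic L) : logicK N ⊆ L :=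
  Set.sInter_subset_of_mem hL

theorem isNormalLogic_addAxioms (L Γ : Set (Formula N)) : IsNormalLogic (addAxioms L Γ) :=
  isNormalLogic_sInter fun _ h => h.1

theorem subset_addAxioms_left (L Γ : Set (Formula N)) : L ⊆ addAxioms L Γ :=
  fun _ hA _ h => h.2.1 hA

theorem subset_addAxioms_right (L Γ : Set (Formula N)) : Γ ⊆ addAxioms L Γ :=
  fun _ hA _ h => h.2.2 hA

theorem addAxioms_subset {L Γ L' : Set (Formula N)} (h : IsNormalLogic L') (hL : L ⊆ L')
    (hΓ : Γ ⊆ L') : addAxioms L Γ ⊆ L' :=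
  Set.sInter_subset_of_mem ⟨h, hL, hΓ⟩

theorem classicalTruth_relabel (i : Fin N) (v : Formula N → Prop) (A : Formula 1) :
    (A.relabel i).classicalTruth v ↔ A.classicalTruth fun B => v (B.relabel i) := by
  induction A with
  | var p => rfl
  | bot => rfl
  | imp A B ihA ihB => simp only [relabel, classicalTruth, ihA, ihB]
  | box j A _ => rfl

theorem relabel_subst (i : Fin N) (σ : ℕ → Formula 1) (A : Formula 1) :
    (A.subst σ).relabel i = (A.relabel i).subst fun p => (σ p).relabel i := by
  induction A with
  | var p => rfl
  | bot => rfl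
  | imp A B ihA ihB => simp only [relabel, Formula.subst, ihA, ihB]
  | box j A ih => simp only [relabel, Formula.subst, ih]

/-- Lets the minimality of a unimodal logic bound its relabelled copy: only its axioms need to be
checked in `L`. -/
theorem IsNormalLogic.relabel_preimage {L : Set (Formula N)} (hL : IsNormalLogic L) (i : Fin N) :
    IsNormalLogic (relabel i ⁻¹' L) where
  taut A hA := hL.taut _ fun v => (classicalTruth_relabel i v A).2 (hA _)
  normality _ := hL.normality i
  subst σ A hA := by
    rw [Set.mem_preimage, relabel_subst]
    exact hL.subst _ _ hA
  mp A B hA hAB := hL.mp _ _ hA hAB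
  nec _ A hA := hL.nec i _ hA

end NormalLogics

/-! ### Finite axiomatization. -/

/-- The formula `◇₁A → □₁A`. -/
def settled (A : Formula 2) : Formula 2 := imp (dia 0 A) (box 0 A)

/-- A finite set of axioms for `logicL`. -/
def axiomsL : Set (Formula 2) :=
  {imp (box 0 (var 0)) (var 0), imp (box 0 (var 0)) (box 0 (box 0 (var 0))),
    imp (box 0 (dia 0 (var 0))) (dia 0 (box 0 (var 0))),
    imp (box 1 (var 0)) (var 0), imp (box 1 (var 0)) (box 1 (box 1 (var 0))),
    dia 0 (box 1 (settled (var 0)))}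

theorem logicS4_subset {L : Set (Formula 1)} (hL : IsNormalLogic L)
    (hT : imp (box 0 (var 0)) (var 0) ∈ L)
    (h4 : imp (box 0 (var 0)) (box 0 (box 0 (var 0))) ∈ L) : logicS4 ⊆ L :=
  addAxioms_subset hL
    (addAxioms_subset hL (logicK_subset hL) (Set.singleton_subset_iff.2 hT))
    (Set.singleton_subset_iff.2 h4)

theorem logicL_subset {L : Set (Formula 2)} (hL : IsNormalLogic L) (h : axiomsL ⊆ L) :
    logicL ⊆ L := by
  simp only [axiomsL, Set.insert_subset_iff, Set.singleton_subset_iff] at h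
  obtain ⟨hT1, h41, hM, hT2, h42, hA⟩ := h
  refine addAxioms_subset hL (addAxioms_subset hL (addAxioms_subset hL (logicK_subset hL) ?_) ?_)
    (Set.singleton_subset_iff.2 hA)
  · exact Set.image_subset_iff.2 (addAxioms_subset (hL.relabel_preimage 0)
      (logicS4_subset (hL.relabel_preimage 0) hT1 h41) (Set.singleton_subset_iff.2 hM))
  · exact Set.image_subset_iff.2 (logicS4_subset (hL.relabel_preimage 1) hT2 h42)

theorem logicS4_T : imp (box 0 (var 0)) (var 0) ∈ logicS4 :=
  subset_addAxioms_left _ _ (subset_addAxioms_right _ _ rfl)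

theorem logicS4_four : imp (box 0 (var 0)) (box 0 (box 0 (var 0))) ∈ logicS4 :=
  subset_addAxioms_right _ _ rfl

theorem relabel_mem_logicL_of_S41 {A : Formula 1} (h : A ∈ logicS41) : A.relabel 0 ∈ logicL :=
  subset_addAxioms_left _ _ (subset_addAxioms_left _ _
    (subset_addAxioms_right _ _ (Set.mem_image_of_mem _ h)))

theorem relabel_mem_logicL_of_S4 {A : Formula 1} (h : A ∈ logicS4) : A.relabel 1 ∈ logicL :=
  subset_addAxioms_left _ _ (subset_addAxioms_right _ _ (Set.mem_image_of_mem _ h))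

theorem axiomsL_subset_logicL : axiomsL ⊆ logicL := by
  simp only [axiomsL, Set.insert_subset_iff, Set.singleton_subset_iff]
  exact ⟨relabel_mem_logicL_of_S41 (subset_addAxioms_left _ _ logicS4_T),
    relabel_mem_logicL_of_S41 (subset_addAxioms_left _ _ logicS4_four),
    relabel_mem_logicL_of_S41 (subset_addAxioms_right _ _ rfl),
    relabel_mem_logicL_of_S4 logicS4_T, relabel_mem_logicL_of_S4 logicS4_four,
    subset_addAxioms_right _ _ rfl⟩

theorem isNormalLogic_logicL : IsNormalLogic logicL := isNormalLogic_addAxioms _ _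

theorem isFinitelyAxiomatizable_logicL : IsFinitelyAxiomatizable logicL := by
  refine ⟨axiomsL, by simp [axiomsL], Set.Subset.antisymm ?_ ?_⟩
  · exact logicL_subset (isNormalLogic_addAxioms _ _) (subset_addAxioms_right _ _)
  · exact addAxioms_subset isNormalLogic_logicL (logicK_subset isNormalLogic_logicL)
      axiomsL_subset_logicL

/-! ### Soundness for Kripke frames. -/

section Soundness

variable {N : ℕ}

theorem KripkeFrame.classicalTruth_sat (F : KripkeFrame.{0} N) (V : ℕ → Set F.World)
    (x : F.World) (A : Formula N) : A.classicalTruth (F.Sat V x) ↔ F.Sat V x A := by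
  induction A with
  | var p => rfl
  | bot => rfl
  | imp A B ihA ihB => simp only [classicalTruth, KripkeFrame.Sat, ihA, ihB]
  | box j A _ => rfl

theorem KripkeFrame.sat_subst (F : KripkeFrame.{0} N) (V : ℕ → Set F.World)
    (σ : ℕ → Formula N) (A : Formula N) (x : F.World) :
    F.Sat V x (A.subst σ) ↔ F.Sat (fun p => {y | F.Sat V y (σ p)}) x A := by
  induction A generalizing x with
  | var p => rfl
  | bot => rfl
  | imp A B ihA ihB => simp only [Formula.subst, KripkeFrame.Sat, ihA, ihB]
  | box j A ih => simp only [Formula.subst, KripkeFrame.Sat, ih]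

theorem KripkeFrame.isNormalLogic_valid (F : KripkeFrame.{0} N) :
    IsNormalLogic {A | F.Valid A} where
  taut A hA V x := (F.classicalTruth_sat V x A).1 (hA _)
  normality _ _ _ h h0 y hy := h y hy (h0 y hy)
  subst σ A hA V x := (F.sat_subst V σ A x).2 (hA _ x)
  mp _ _ hA hAB V x := hAB V x (hA V x)
  nec _ _ hA V _ y _ := hA V y

theorem KripkeFrame.logicL_subset_valid (F : KripkeFrame.{0} 2) (hrefl : ∀ i x, F.R i x x)
    (htrans : ∀ i x y z, F.R i x y → F.R i y z → F.R i x z)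
    (hfin : ∀ x, ∃ y, F.R 0 x y ∧ ∀ z, F.R 1 y z → ∀ w, F.R 0 z w → w = z) :
    logicL ⊆ {A | F.Valid A} := by
  refine logicL_subset F.isNormalLogic_valid ?_
  simp only [axiomsL, Set.insert_subset_iff, Set.singleton_subset_iff, Set.mem_ofPred_eq]
  refine ⟨fun V x h => h x (hrefl 0 x), fun V x h y hy z hz => h z (htrans 0 x y z hy hz),
    fun V x h h' => ?_, fun V x h => h x (hrefl 1 x),
    fun V x h y hy z hz => h z (htrans 1 x y z hy hz), fun V x h => ?_⟩
  -- By reflexivity `y` is its own R₂-successor, so it R₁-sees only itself, and there ◇₁p and □₁p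
  -- both amount to p.
  · obtain ⟨y, hxy, hy⟩ := hfin x
    refine h y hxy fun z hz hp => h' y hxy fun w hw => ?_
    rw [hy y (hrefl 1 y) w hw]
    rwa [hy y (hrefl 1 y) z hz] at hp
  · obtain ⟨y, hxy, hy⟩ := hfin x
    refine h y hxy fun z hz hd w hw => ?_
    by_contra hn
    refine hd fun v hv hp => hn ?_
    rw [hy z hz w hw]
    rwa [hy z hz v hv] at hp

end Soundness

/-! ### Complete theories and the canonical relations. -/

section Theories

variable {N : ℕ} {L : Set (Formula N)}

/-- Sets of formulas that contain `L` and are closed under modus ponens. -/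
structure IsTheory (L T : Set (Formula N)) : Prop where
  subset : L ⊆ T
  mp : ∀ A B : Formula N, A ∈ T → imp A B ∈ T → B ∈ T

/-- Consistent theories that contain each formula or its negation. -/
structure IsCompleteTheory (L T : Set (Formula N)) : Prop extends IsTheory L T where
  bot_notMem : bot ∉ T
  mem_or_neg_mem : ∀ A : Formula N, A ∈ T ∨ neg A ∈ T

/-- The canonical accessibility relation. -/
def CanonicalRel (i : Fin N) (x y : Set (Formula N)) : Prop := ∀ A, box i A ∈ x → A ∈ y

theorem IsTheory.taut_mem {T : Set (Formula N)} (hL : IsNormalLogic L) (hT : IsTheory L T)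
    {A : Formula N} (hA : A.IsTautology) : A ∈ T :=
  hT.subset (hL.taut A hA)

theorem IsTheory.conditional {T : Set (Formula N)} (hL : IsNormalLogic L) (hT : IsTheory L T)
    (C : Formula N) : IsTheory L {B | imp C B ∈ T} where
  subset B hB := hT.mp B _ (hT.subset hB) (hT.taut_mem hL fun v h _ => h)
  mp A B hA hAB := by
    refine hT.mp _ _ hAB (hT.mp _ _ hA (hT.taut_mem hL fun v => ?_))
    simp only [classicalTruth]
    tauto

theorem IsTheory.box_preimage {T : Set (Formula N)} (hL : IsNormalLogic L) (hT : IsTheory L T)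
    (i : Fin N) : IsTheory L {B | box i B ∈ T} where
  subset B hB := hT.subset (hL.nec i B hB)
  mp A B hA hAB := hT.mp _ _ hA (hT.mp _ _ hAB (hT.subset
    (hL.subst (fun n => if n = 0 then A else B) _ (hL.normality i))))

/-- Lindenbaum's lemma: a theory maximal among those omitting `A` is complete. -/
theorem IsTheory.exists_complete {T : Set (Formula N)} (hL : IsNormalLogic L)
    (hT : IsTheory L T) {A : Formula N} (hA : A ∉ T) :
    ∃ x, IsCompleteTheory L x ∧ T ⊆ x ∧ A ∉ x := by
  obtain ⟨x, hTx, ⟨hx, hAx⟩, hmax⟩ := zorn_subset_nonempty {T' | IsTheory L T' ∧ A ∉ T'}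
    (fun c hc hchain hne => by
      obtain ⟨T₀, hT₀⟩ := hne
      refine ⟨⋃₀ c, ⟨⟨fun B hB => ⟨T₀, hT₀, (hc hT₀).1.subset hB⟩, ?_⟩, ?_⟩,
        fun s hs => Set.subset_sUnion_of_mem hs⟩
      · rintro B C ⟨s, hs, hB⟩ ⟨t, ht, hBC⟩
        rcases hchain.total hs ht with hst | hts
        · exact ⟨t, ht, (hc ht).1.mp B C (hst hB) hBC⟩
        · exact ⟨s, hs, (hc hs).1.mp B C hB (hts hBC)⟩
      · rintro ⟨s, hs, h⟩
        exact (hc hs).2 h) T ⟨hT, hA⟩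
  -- Otherwise the theory of all `C` with B → C in `x` would extend `x`, still omit `A`, and contain
  -- `B`, against maximality.
  have key : ∀ B, B ∉ x → imp B A ∈ x := fun B hB => by
    by_contra hn
    have hsub : x ⊆ {C | imp B C ∈ x} := fun C hC =>
      hx.mp C _ hC (hx.taut_mem hL fun v h _ => h)
    exact hB (hmax (y := {C | imp B C ∈ x}) ⟨hx.conditional hL B, hn⟩ hsub
      (hx.taut_mem hL fun v h => h))
  refine ⟨x, ⟨hx, fun hb => hAx (hx.mp _ _ hb (hx.taut_mem hL fun v h => h.elim)), fun B => ?_⟩,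
    hTx, hAx⟩
  by_contra! hn
  refine hAx (hx.mp _ _ (key _ hn.2) (hx.mp _ _ (key _ hn.1) (hx.taut_mem hL fun v => ?_)))
  simp only [neg, classicalTruth]
  tauto

variable {x : Set (Formula N)}

theorem IsCompleteTheory.imp_mem_iff (hL : IsNormalLogic L) (hx : IsCompleteTheory L x)
    {A B : Formula N} : imp A B ∈ x ↔ (A ∈ x → B ∈ x) := by
  refine ⟨fun h hA => hx.mp A B hA h, fun h => ?_⟩
  rcases hx.mem_or_neg_mem A with hA | hA
  · exact hx.mp _ _ (h hA) (hx.taut_mem hL fun v h _ => h)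
  · exact hx.mp _ _ hA (hx.taut_mem hL fun v h h' => (h h').elim)

theorem IsCompleteTheory.neg_mem_iff (hL : IsNormalLogic L) (hx : IsCompleteTheory L x)
    {A : Formula N} : neg A ∈ x ↔ A ∉ x := by
  have := hx.bot_notMem
  rw [neg, hx.imp_mem_iff hL]
  tauto

theorem IsCompleteTheory.box_mem_iff (hL : IsNormalLogic L) (hx : IsCompleteTheory L x)
    {i : Fin N} {A : Formula N} :
    box i A ∈ x ↔ ∀ y, IsCompleteTheory L y → CanonicalRel i x y → A ∈ y := by
  refine ⟨fun h y _ hxy => hxy A h, fun h => ?_⟩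
  by_contra hn
  obtain ⟨y, hy, hxy, hA⟩ := (hx.box_preimage hL i).exists_complete hL hn
  exact hA (h y hy hxy)

theorem IsCompleteTheory.dia_mem_iff (hL : IsNormalLogic L) (hx : IsCompleteTheory L x)
    {i : Fin N} {A : Formula N} :
    dia i A ∈ x ↔ ∃ y, IsCompleteTheory L y ∧ CanonicalRel i x y ∧ A ∈ y := by
  rw [dia, hx.neg_mem_iff hL, hx.box_mem_iff hL]
  push Not
  refine exists_congr fun y => and_congr_right fun hy => and_congr_right fun _ => ?_
  rw [hy.neg_mem_iff hL, not_not]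

end Theories

/-! ### Settling formulas along the first canonical relation. -/

section CanonicalModel

variable {x y : Set (Formula 2)}

theorem axiom_instance_mem (hx : IsCompleteTheory logicL x) (A : Formula 2) {B : Formula 2}
    (hB : B ∈ axiomsL) : B.subst (fun _ => A) ∈ x :=
  hx.subset (isNormalLogic_logicL.subst _ _ (axiomsL_subset_logicL hB))

theorem mem_of_box_mem (hx : IsCompleteTheory logicL x) (i : Fin 2) {A : Formula 2}
    (h : box i A ∈ x) : A ∈ x := by
  refine hx.mp _ _ h ?_
  have h0 := axiom_instance_mem hx A (B := imp (box 0 (var 0)) (var 0)) (by simp [axiomsL])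
  have h1 := axiom_instance_mem hx A (B := imp (box 1 (var 0)) (var 0)) (by simp [axiomsL])
  fin_cases i
  exacts [h0, h1]

theorem box_box_mem (hx : IsCompleteTheory logicL x) (i : Fin 2) {A : Formula 2}
    (h : box i A ∈ x) : box i (box i A) ∈ x := by
  refine hx.mp _ _ h ?_
  have h0 := axiom_instance_mem hx A (B := imp (box 0 (var 0)) (box 0 (box 0 (var 0))))
    (by simp [axiomsL])
  have h1 := axiom_instance_mem hx A (B := imp (box 1 (var 0)) (box 1 (box 1 (var 0))))
    (by simp [axiomsL])
  fin_cases i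
  exacts [h0, h1]

theorem canonicalRel_trans (hx : IsCompleteTheory logicL x) {i : Fin 2} {z : Set (Formula 2)}
    (hxy : CanonicalRel i x y) (hyz : CanonicalRel i y z) : CanonicalRel i x z :=
  fun _ hA => hyz _ (hxy _ (box_box_mem hx i hA))

theorem settled_mem_iff (hx : IsCompleteTheory logicL x) {A : Formula 2} :
    settled A ∈ x ↔ box 0 (neg A) ∈ x ∨ box 0 A ∈ x := by
  rw [settled, hx.imp_mem_iff isNormalLogic_logicL, dia, hx.neg_mem_iff isNormalLogic_logicL]
  tauto

theorem settled_mem_of_rel (hx : IsCompleteTheory logicL x) (hy : IsCompleteTheory logicL y)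
    (hxy : CanonicalRel 0 x y) {A : Formula 2} (h : settled A ∈ x) : settled A ∈ y := by
  rw [settled_mem_iff hy]
  exact ((settled_mem_iff hx).1 h).imp (fun h => hxy _ (box_box_mem hx 0 h))
    fun h => hxy _ (box_box_mem hx 0 h)

theorem mem_iff_of_settled (hx : IsCompleteTheory logicL x) (hy : IsCompleteTheory logicL y)
    (hxy : CanonicalRel 0 x y) {A : Formula 2} (h : settled A ∈ x) : A ∈ y ↔ A ∈ x := by
  rcases (settled_mem_iff hx).1 h with h | h
  · have h1 := (hx.neg_mem_iff isNormalLogic_logicL).1 (mem_of_box_mem hx 0 h)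
    have h2 := (hy.neg_mem_iff isNormalLogic_logicL).1 (hxy _ h)
    tauto
  · exact iff_of_true (hxy _ h) (mem_of_box_mem hx 0 h)

/-- If □₁◇₁A holds, the S4.1 axiom gives a successor with □₁A; if not, some successor refutes ◇₁A,
and the implication is vacuous there. -/
theorem exists_rel_settled (hx : IsCompleteTheory logicL x) (A : Formula 2) :
    ∃ y, IsCompleteTheory logicL y ∧ CanonicalRel 0 x y ∧ settled A ∈ y := by
  have hL := isNormalLogic_logicL
  have hM := axiom_instance_mem hx A (B := imp (box 0 (dia 0 (var 0))) (dia 0 (box 0 (var 0))))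
    (by simp [axiomsL])
  by_cases h : box 0 (dia 0 A) ∈ x
  · obtain ⟨y, hy, hxy, hA⟩ := (hx.dia_mem_iff hL).1 (hx.mp _ _ h hM)
    exact ⟨y, hy, hxy, (settled_mem_iff hy).2 (Or.inr hA)⟩
  · rw [hx.box_mem_iff hL] at h
    push Not at h
    obtain ⟨y, hy, hxy, hA⟩ := h
    exact ⟨y, hy, hxy, (hy.imp_mem_iff hL).2 fun h => absurd h hA⟩

theorem exists_rel_forall_settled (l : List (Formula 2)) (hx : IsCompleteTheory logicL x) :
    ∃ y, IsCompleteTheory logicL y ∧ CanonicalRel 0 x y ∧ ∀ A ∈ l, settled A ∈ y := by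
  induction l with
  | nil => exact ⟨x, hx, fun A h => mem_of_box_mem hx 0 h, by simp⟩
  | cons A l ih =>
    obtain ⟨y, hy, hxy, hl⟩ := ih
    obtain ⟨z, hz, hyz, hA⟩ := exists_rel_settled hy A
    refine ⟨z, hz, canonicalRel_trans hx hxy hyz, ?_⟩
    simpa [hA] using fun B hB => settled_mem_of_rel hy hz hyz (hl B hB)

/-- Settle the formulas □₂(settled A) themselves: the extra axiom says each is ◇₁-possible, so being
settled makes it □₁-necessary and hence true. -/
theorem exists_rel_forall_box_settled (l : List (Formula 2)) (hx : IsCompleteTheory logicL x) :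
    ∃ y, IsCompleteTheory logicL y ∧ CanonicalRel 0 x y ∧ ∀ A ∈ l, box 1 (settled A) ∈ y := by
  obtain ⟨y, hy, hxy, hl⟩ := exists_rel_forall_settled (l.map fun A => box 1 (settled A)) hx
  refine ⟨y, hy, hxy, fun A hA => mem_of_box_mem hy 0 (hy.mp _ _ ?_ (hl _ (List.mem_map_of_mem hA)))⟩
  exact axiom_instance_mem hy A (B := dia 0 (box 1 (settled (var 0)))) (by simp [axiomsL])

end CanonicalModel

/-! ### Types coded by binary digits, and the finite frames built from them. -/

section Types

/-- The `i`-th binary digit of `m` is `1`. -/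
def Bit (m i : ℕ) : Prop := m / 2 ^ i % 2 = 1

theorem exists_bit_iff (n : ℕ) (P : ℕ → Prop) :
    ∃ m < 2 ^ n, ∀ i < n, (Bit m i ↔ P i) := by
  classical
  refine ⟨Nat.ofBits fun i : Fin n => decide (P i), Nat.ofBits_lt_two_pow _, fun i hi => ?_⟩
  have h := Nat.testBit_ofBits_lt (fun i : Fin n => decide (P i)) i hi
  rw [Nat.testBit_eq_decide_div_mod_eq, decide_eq_decide] at h
  exact h

/-- Accessibility between types `t`, `s` (numbers whose digits are the truth values of the
formulas with the corresponding codes), where `E` codes a set of final types. -/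
def TypeRel (n E i t s : ℕ) : Prop :=
  (∀ a < n + 1, Bit t (3 * (2 * a + i) + 3) → Bit s (3 * (2 * a + i) + 3)) ∧
    (i = 0 → Bit E t → s = t) ∧ (i = 1 → Bit E t → Bit E s)

/-- The conditions on a type `t` in the model on the set of types coded by `W`. -/
def IsGoodType (n W E t : ℕ) : Prop :=
  ¬ Bit t 0 ∧
  (∀ a < n + 1, ∀ b < n + 1, 3 * Nat.pair a b + 2 < n + 1 →
    (Bit t (3 * Nat.pair a b + 2) ↔ (Bit t a → Bit t b))) ∧
  (∀ i < 2, ∀ a < n + 1, 3 * (2 * a + i) + 3 < n + 1 →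
    (Bit t (3 * (2 * a + i) + 3) ↔
      ∀ s < 2 ^ (n + 1), Bit W s → TypeRel n E i t s → Bit s a)) ∧
  ∃ s < 2 ^ (n + 1), Bit W s ∧ Bit E s ∧ TypeRel n E 0 t s

/-- There is a finite model made of types that refutes the formula with code `n`. -/
def Refutable (n : ℕ) : Prop :=
  ∃ W < 2 ^ 2 ^ (n + 1), ∃ E < 2 ^ 2 ^ (n + 1),
    (∀ t < 2 ^ (n + 1), Bit W t → IsGoodType n W E t) ∧ ∃ t < 2 ^ (n + 1), Bit W t ∧ ¬ Bit t n

/-- Every number is a code, so quantifiers over codes need no well-formedness test. -/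
theorem code_surjective (n : ℕ) : ∃ A : Formula 2, A.code = n := by
  induction n using Nat.strong_induction_on with
  | _ n ih =>
    obtain rfl | ⟨k, rfl | rfl | rfl⟩ :
        n = 0 ∨ ∃ k, n = 3 * k + 1 ∨ n = 3 * k + 2 ∨ n = 3 * k + 3 := by
      by_cases h : n = 0
      · exact Or.inl h
      · exact Or.inr ⟨(n - 1) / 3, by omega⟩
    · exact ⟨bot, rfl⟩
    · exact ⟨var k, rfl⟩
    · obtain ⟨A, hA⟩ := ih k.unpair.1 (by have := Nat.unpair_left_le k; omega)
      obtain ⟨B, hB⟩ := ih k.unpair.2 (by have := Nat.unpair_right_le k; omega)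
      exact ⟨imp A B, by rw [code, hA, hB, Nat.pair_unpair]⟩
    · obtain ⟨A, hA⟩ := ih (k / 2) (by omega)
      refine ⟨box ⟨k % 2, by omega⟩ A, ?_⟩
      simp only [code, hA]
      omega

theorem code_left_lt (A B : Formula 2) : A.code < (imp A B).code := by
  have := Nat.left_le_pair A.code B.code
  simp only [code]
  omega

theorem code_right_lt (A B : Formula 2) : B.code < (imp A B).code := by
  have := Nat.right_le_pair A.code B.code
  simp only [code]
  omega

theorem code_lt_box (i : Fin 2) (A : Formula 2) : A.code < (box i A).code := by
  simp only [code]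
  omega

/-- The frame of types coded by `W` and `E`. -/
def typeFrame (n W E : ℕ) (h : ∃ t < 2 ^ (n + 1), Bit W t) : KripkeFrame.{0} 2 where
  World := {t : ℕ // t < 2 ^ (n + 1) ∧ Bit W t}
  nonempty := let ⟨t, ht⟩ := h; ⟨⟨t, ht⟩⟩
  R i t s := TypeRel n E i t.1 s.1

theorem finite_typeFrame (n W E : ℕ) (h : ∃ t < 2 ^ (n + 1), Bit W t) :
    Finite (typeFrame n W E h).World :=
  ((Set.finite_lt_nat (2 ^ (n + 1))).subset fun _ ht => ht.1 :
    {t : ℕ | t < 2 ^ (n + 1) ∧ Bit W t}.Finite).to_subtype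

/-- Persistence of boxed formulas is reflexive and transitive, and the cuts at `E` preserve this. A
type in `E` R₁-sees only itself and R₂-sees only `E`, so the last clause of `IsGoodType` supplies
the required successor. -/
theorem logicL_subset_typeFrame_valid {n W E : ℕ} (h : ∃ t < 2 ^ (n + 1), Bit W t)
    (hgood : ∀ t < 2 ^ (n + 1), Bit W t → IsGoodType n W E t) :
    logicL ⊆ {A | (typeFrame n W E h).Valid A} := by
  refine (typeFrame n W E h).logicL_subset_valid (fun i t => ?_) (fun i t s r hts hsr => ?_)
    fun t => ?_
  · exact ⟨fun _ _ => id, fun _ _ => rfl, fun _ => id⟩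
  · refine ⟨fun a ha => hsr.1 a ha ∘ hts.1 a ha, fun hi ht => ?_,
      fun hi ht => hsr.2.2 hi (hts.2.2 hi ht)⟩
    have hst := hts.2.1 hi ht
    rw [← hst] at ht ⊢
    exact hsr.2.1 hi ht
  · obtain ⟨s, hs, hsW, hsE, hts⟩ := (hgood t.1 t.2.1 t.2.2).2.2.2
    exact ⟨⟨s, hs, hsW⟩, hts, fun r hsr w hrw =>
      Subtype.ext (hrw.2.1 rfl (hsr.2.2 rfl hsE))⟩

theorem sat_typeFrame_iff {n W E : ℕ} (h : ∃ t < 2 ^ (n + 1), Bit W t)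
    (hgood : ∀ t < 2 ^ (n + 1), Bit W t → IsGoodType n W E t) (A : Formula 2) (hA : A.code < n + 1) (t : (typeFrame n W E h).World) :
    (typeFrame n W E h).Sat (fun p => {t | Bit t.1 (3 * p + 1)}) t A ↔ Bit t.1 A.code := by
  induction A generalizing t with
  | var p => rfl
  | bot => exact iff_of_false id (hgood t.1 t.2.1 t.2.2).1
  | imp A B ihA ihB =>
    have hA' := (code_left_lt A B).trans hA
    have hB' := (code_right_lt A B).trans hA
    exact (imp_congr (ihA hA' t) (ihB hB' t)).trans
      ((hgood t.1 t.2.1 t.2.2).2.1 _ hA' _ hB' hA).symm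
  | box i A ih =>
    have hA' := (code_lt_box i A).trans hA
    refine Iff.trans ?_ ((hgood t.1 t.2.1 t.2.2).2.2.1 i i.2 _ hA' hA).symm
    exact ⟨fun H s hs hsW hts => (ih hA' ⟨s, hs, hsW⟩).1 (H ⟨s, hs, hsW⟩ hts),
      fun H s hts => (ih hA' s).2 (H s.1 s.2.1 s.2.2 hts)⟩

end Types

/-! ### Completeness by filtration, and the finite model property. -/

theorem exists_finite_frame_of_refutable {A : Formula 2} (hA : Refutable A.code) :
    ∃ F : KripkeFrame.{0} 2, Finite F.World ∧ logicL ⊆ {B | F.Valid B} ∧ ¬ F.Valid A := by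
  obtain ⟨W, -, E, -, hgood, t, ht, htW, htA⟩ := hA
  have h : ∃ t < 2 ^ (A.code + 1), Bit W t := ⟨t, ht, htW⟩
  exact ⟨typeFrame A.code W E h, finite_typeFrame _ _ _ h, logicL_subset_typeFrame_valid h hgood,
    fun hv => htA ((sat_typeFrame_iff h hgood A (Nat.lt_succ_self _) ⟨t, ht, htW⟩).1 (hv _ _))⟩

/-- `t` is the type of the theory `x`. -/
def IsTypeOf (n t : ℕ) (x : Set (Formula 2)) : Prop :=
  t < 2 ^ (n + 1) ∧ ∀ A : Formula 2, A.code < n + 1 → (Bit t A.code ↔ A ∈ x)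

theorem exists_isTypeOf (n : ℕ) (x : Set (Formula 2)) : ∃ t, IsTypeOf n t x := by
  obtain ⟨t, ht, h⟩ := exists_bit_iff (n + 1) fun c => ∃ A ∈ x, A.code = c
  refine ⟨t, ht, fun A hA => (h _ hA).trans ⟨?_, fun hx => ⟨A, hx, rfl⟩⟩⟩
  rintro ⟨B, hB, hBA⟩
  rwa [← code_injective hBA]

theorem bit_eq_false_of_lt {n t i : ℕ} (ht : t < 2 ^ n) (hi : n ≤ i) : ¬ Bit t i := by
  rw [Bit, Nat.div_eq_of_lt (ht.trans_le (Nat.pow_le_pow_right two_pos hi))]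
  decide

theorem eq_of_bit_iff {n t s : ℕ} (ht : t < 2 ^ n) (hs : s < 2 ^ n)
    (h : ∀ i < n, (Bit t i ↔ Bit s i)) : t = s := by
  refine Nat.eq_of_testBit_eq fun i => ?_
  rw [Nat.testBit_eq_decide_div_mod_eq, Nat.testBit_eq_decide_div_mod_eq, decide_eq_decide]
  rcases lt_or_ge i n with hi | hi
  · exact h i hi
  · exact iff_of_false (bit_eq_false_of_lt ht hi) (bit_eq_false_of_lt hs hi)

theorem refutable_of_notMem {A : Formula 2} (hA : A ∉ logicL) : Refutable A.code := by
  have hL := isNormalLogic_logicL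
  obtain ⟨n, hn⟩ : ∃ n, n = A.code := ⟨_, rfl⟩
  rw [← hn]
  choose dec hdec using code_surjective
  let Final : Set (Formula 2) → Prop := fun x =>
    ∀ B : Formula 2, B.code < n + 1 → box 1 (settled B) ∈ x
  have hsettled : ∀ x, IsCompleteTheory logicL x → Final x → ∀ B : Formula 2,
      B.code < n + 1 → settled B ∈ x := fun x hx hf B hB => mem_of_box_mem hx 1 (hf B hB)
  have hex : ∀ x, IsCompleteTheory logicL x →
      ∃ y, IsCompleteTheory logicL y ∧ CanonicalRel 0 x y ∧ Final y := fun x hx => by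
    obtain ⟨y, hy, hxy, hl⟩ := exists_rel_forall_box_settled ((List.range (n + 1)).map dec) hx
    refine ⟨y, hy, hxy, fun B hB => hl B (List.mem_map.2 ⟨B.code, List.mem_range.2 hB, ?_⟩)⟩
    exact code_injective (hdec _)
  obtain ⟨W, hWlt, hW⟩ := exists_bit_iff (2 ^ (n + 1)) fun t =>
    ∃ x, IsCompleteTheory logicL x ∧ IsTypeOf n t x
  obtain ⟨E, hElt, hE⟩ := exists_bit_iff (2 ^ (n + 1)) fun t =>
    ∃ x, IsCompleteTheory logicL x ∧ Final x ∧ IsTypeOf n t x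
  have hbox : ∀ (x y : Set (Formula 2)) (t s : ℕ) (i : Fin 2), IsCompleteTheory logicL x →
      IsTypeOf n t x → IsTypeOf n s y → CanonicalRel i x y → ∀ a < n + 1,
      Bit t (3 * (2 * a + i) + 3) → Bit s (3 * (2 * a + i) + 3) := by
    intro x y t s i hx ht hs hxy a ha hb
    have hc : (box i (dec a)).code = 3 * (2 * a + i) + 3 := by simp only [code, hdec]
    rw [← hc] at hb ⊢
    have hlt : (box i (dec a)).code < n + 1 := by
      -- Only the code of the unboxed formula is bounded by `n`; the digits of a type beyond `n`
      -- vanish.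
      by_contra hge
      exact bit_eq_false_of_lt ht.1 (not_lt.1 hge) hb
    exact (hs.2 _ hlt).2 (hxy _ (box_box_mem hx i ((ht.2 _ hlt).1 hb)))
  refine ⟨W, hWlt, E, hElt, fun t ht htW => ?_, ?_⟩
  · obtain ⟨x, hx, htx⟩ := (hW t ht).1 htW
    refine ⟨fun h0 => hx.bot_notMem ((htx.2 bot (Nat.succ_pos n)).1 h0),
      fun a ha b hb hab => ?_, fun i hi a ha hia => ?_, ?_⟩
    · have hc : (imp (dec a) (dec b)).code = 3 * Nat.pair a b + 2 := by simp only [code, hdec]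
      have h1 := htx.2 (dec a) (by rwa [hdec])
      have h2 := htx.2 (dec b) (by rwa [hdec])
      have h3 := htx.2 (imp (dec a) (dec b)) (by rwa [hc])
      rw [hdec] at h1 h2
      rw [hc] at h3
      rw [h1, h2, h3]
      exact hx.imp_mem_iff hL
    · have hc : (box ⟨i, hi⟩ (dec a)).code = 3 * (2 * a + i) + 3 := by simp only [code, hdec]
      have hda : (dec a).code < n + 1 := by rwa [hdec]
      have hlt : (box ⟨i, hi⟩ (dec a)).code < n + 1 := by rwa [hc]
      have hmem := htx.2 _ hlt
      rw [hc] at hmem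
      constructor
      · intro hb s hs hsW hts
        obtain ⟨y, hy, hsy⟩ := (hW s hs).1 hsW
        have h1 := hsy.2 _ hlt
        rw [hc] at h1
        have h2 := (hsy.2 _ hda).2 (mem_of_box_mem hy _ (h1.1 (hts.1 a ha hb)))
        rwa [hdec] at h2
      · intro H
        by_contra hb
        -- A type in `E` may also be realized by non-final theories. A final representative is
        -- chosen so that the witness for the failing box respects the cuts in `TypeRel`.
        obtain ⟨x', hx', htx', hfin⟩ : ∃ x', IsCompleteTheory logicL x' ∧ IsTypeOf n t x' ∧
            (Bit E t → Final x') := by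
          by_cases htE : Bit E t
          · obtain ⟨x', hx', hf, htx'⟩ := (hE t ht).1 htE
            exact ⟨x', hx', htx', fun _ => hf⟩
          · exact ⟨x, hx, htx, fun h => absurd h htE⟩
        have hmem' := htx'.2 _ hlt
        rw [hc] at hmem'
        rw [hmem', hx'.box_mem_iff hL] at hb
        push Not at hb
        obtain ⟨y, hy, hxy, hay⟩ := hb
        obtain ⟨s, hsy⟩ := exists_isTypeOf n y
        refine hay ((hsy.2 _ hda).1 ?_)
        rw [hdec]
        refine H s hsy.1 ((hW s hsy.1).2 ⟨y, hy, hsy⟩)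
          ⟨hbox x' y t s ⟨i, hi⟩ hx' htx' hsy hxy, fun hi0 htE => ?_, fun hi1 htE => ?_⟩
        · subst hi0
          refine eq_of_bit_iff hsy.1 ht fun c hcn => ?_
          have h1 := hsy.2 (dec c) (by rwa [hdec])
          have h2 := htx'.2 (dec c) (by rwa [hdec])
          rw [hdec] at h1 h2
          rw [h1, h2]
          exact mem_iff_of_settled hx' hy hxy
            (hsettled x' hx' (hfin htE) _ (by rwa [hdec]))
        · subst hi1
          exact (hE s hsy.1).2 ⟨y, hy, fun B hB =>
            hxy _ (box_box_mem hx' 1 (hfin htE B hB)), hsy⟩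
    -- A type in `E` sees itself; for any other type the cuts are void, so the type of a final
    -- canonical successor serves.
    · by_cases htE : Bit E t
      · exact ⟨t, ht, htW, htE, fun _ _ => id, fun _ _ => rfl, fun _ => id⟩
      · obtain ⟨y, hy, hxy, hf⟩ := hex x hx
        obtain ⟨s, hsy⟩ := exists_isTypeOf n y
        exact ⟨s, hsy.1, (hW s hsy.1).2 ⟨y, hy, hsy⟩, (hE s hsy.1).2 ⟨y, hy, hf, hsy⟩,
          hbox x y t s 0 hx htx hsy hxy, fun _ h => absurd h htE, fun _ h => absurd h htE⟩
  · have hLT : IsTheory logicL logicL := ⟨subset_rfl, hL.mp⟩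
    obtain ⟨x, hx, -, hAx⟩ := hLT.exists_complete hL hA
    obtain ⟨t, ht⟩ := exists_isTypeOf n x
    refine ⟨t, ht.1, (hW t ht.1).2 ⟨x, hx, ht⟩, fun hb => hAx ((ht.2 A (by omega)).1 ?_)⟩
    rwa [← hn]

theorem notMem_logicL_iff {A : Formula 2} : A ∉ logicL ↔ Refutable A.code := by
  refine ⟨refutable_of_notMem, fun h hA => ?_⟩
  obtain ⟨F, -, hF, hn⟩ := exists_finite_frame_of_refutable h
  exact hn (hF hA)

theorem hasFiniteModelProperty_logicL : HasFiniteModelProperty logicL := by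
  refine ⟨{F | Finite F.World ∧ logicL ⊆ {A | F.Valid A}}, fun F hF => hF.1,
    Set.Subset.antisymm (fun A hA F hF => hF.2 hA) fun A hA => ?_⟩
  by_contra hn
  obtain ⟨F, hfin, hF, hv⟩ := exists_finite_frame_of_refutable (refutable_of_notMem hn)
  exact hv (hA F ⟨hfin, hF⟩)

/-! ### Primitive recursiveness of refutability. -/

section Decidability

variable {α : Type*} [Primcodable α]

theorem PrimrecPred.imp {p q : α → Prop} (hp : PrimrecPred p) (hq : PrimrecPred q) :
    PrimrecPred fun a => p a → q a :=
  (hp.not.or hq).of_eq fun _ => imp_iff_not_or.symm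

theorem PrimrecPred.iff {p q : α → Prop} (hp : PrimrecPred p) (hq : PrimrecPred q) :
    PrimrecPred fun a => p a ↔ q a :=
  ((PrimrecPred.imp hp hq).and (PrimrecPred.imp hq hp)).of_eq fun _ => iff_def.symm

theorem PrimrecPred.forall_lt_fun {R : α → ℕ → Prop} {f : α → ℕ} (hf : Primrec f)
    (hR : PrimrecPred fun p : α × ℕ => R p.1 p.2) : PrimrecPred fun a => ∀ x < f a, R a x := by
  have h : PrimrecRel fun (x : ℕ) (a : α) => R a x := hR.comp (Primrec.snd.pair Primrec.fst)
  exact (h.forall_mem_list.comp (Primrec.list_range.comp hf) Primrec.id).of_eq (by simp)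

theorem PrimrecPred.exists_lt_fun {R : α → ℕ → Prop} {f : α → ℕ} (hf : Primrec f)
    (hR : PrimrecPred fun p : α × ℕ => R p.1 p.2) : PrimrecPred fun a => ∃ x < f a, R a x := by
  have h : PrimrecRel fun (x : ℕ) (a : α) => R a x := hR.comp (Primrec.snd.pair Primrec.fst)
  exact (h.exists_mem_list.comp (Primrec.list_range.comp hf) Primrec.id).of_eq (by simp)

theorem primrec_two_pow {f : α → ℕ} (hf : Primrec f) : Primrec fun a => 2 ^ f a :=
  (Primrec₂.unpaired'.1 Nat.Primrec.pow).comp (Primrec.const 2) hf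

theorem primrecPred_bit {f g : α → ℕ} (hf : Primrec f) (hg : Primrec g) :
    PrimrecPred fun a => Bit (f a) (g a) :=
  Primrec.eq.comp (Primrec.nat_mod.comp (Primrec.nat_div.comp hf (primrec_two_pow hg))
    (Primrec.const 2)) (Primrec.const 1)

theorem primrec_boxCode {f g : α → ℕ} (hf : Primrec f) (hg : Primrec g) :
    Primrec fun a => 3 * (2 * f a + g a) + 3 :=
  Primrec.nat_add.comp (Primrec.nat_mul.comp (Primrec.const 3)
    (Primrec.nat_add.comp (Primrec.nat_mul.comp (Primrec.const 2) hf) hg)) (Primrec.const 3)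

theorem primrec_impCode {f g : α → ℕ} (hf : Primrec f) (hg : Primrec g) :
    Primrec fun a => 3 * Nat.pair (f a) (g a) + 2 :=
  Primrec.nat_add.comp (Primrec.nat_mul.comp (Primrec.const 3)
    (Primrec₂.natPair.comp hf hg)) (Primrec.const 2)

theorem primrecPred_typeRel {n E i t s : α → ℕ} (hn : Primrec n) (hE : Primrec E)
    (hi : Primrec i) (ht : Primrec t) (hs : Primrec s) :
    PrimrecPred fun a => TypeRel (n a) (E a) (i a) (t a) (s a) := by
  have hb : Primrec fun p : α × ℕ => 3 * (2 * p.2 + i p.1) + 3 :=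
    primrec_boxCode Primrec.snd (hi.comp Primrec.fst)
  exact (PrimrecPred.forall_lt_fun (Primrec.succ.comp hn)
    (PrimrecPred.imp (primrecPred_bit (ht.comp Primrec.fst) hb)
      (primrecPred_bit (hs.comp Primrec.fst) hb))).and
    ((PrimrecPred.imp (Primrec.eq.comp hi (Primrec.const 0))
      (PrimrecPred.imp (primrecPred_bit hE ht) (Primrec.eq.comp hs ht))).and
    (PrimrecPred.imp (Primrec.eq.comp hi (Primrec.const 1))
      (PrimrecPred.imp (primrecPred_bit hE ht) (primrecPred_bit hE hs))))

theorem primrecPred_isGoodType {n W E t : α → ℕ} (hn : Primrec n) (hW : Primrec W)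
    (hE : Primrec E) (ht : Primrec t) :
    PrimrecPred fun a => IsGoodType (n a) (W a) (E a) (t a) := by
  have hn1 : Primrec fun a => n a + 1 := Primrec.succ.comp hn
  have hN : Primrec fun a => 2 ^ (n a + 1) := primrec_two_pow hn1
  refine (primrecPred_bit ht (Primrec.const 0)).not.and (PrimrecPred.and ?_ (PrimrecPred.and ?_ ?_))
  · have h1 : Primrec fun p : (α × ℕ) × ℕ => p.1.1 := Primrec.fst.comp Primrec.fst
    have ha : Primrec fun p : (α × ℕ) × ℕ => p.1.2 := Primrec.snd.comp Primrec.fst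
    have hb : Primrec fun p : (α × ℕ) × ℕ => p.2 := Primrec.snd
    have hc := primrec_impCode ha hb
    exact PrimrecPred.forall_lt_fun hn1 (PrimrecPred.forall_lt_fun (hn1.comp Primrec.fst)
      (PrimrecPred.imp (Primrec.nat_lt.comp hc (hn1.comp h1))
        (PrimrecPred.iff (primrecPred_bit (ht.comp h1) hc)
          (PrimrecPred.imp (primrecPred_bit (ht.comp h1) ha) (primrecPred_bit (ht.comp h1) hb)))))
  · have h1 : Primrec fun p : (α × ℕ) × ℕ => p.1.1 := Primrec.fst.comp Primrec.fst
    have hi : Primrec fun p : (α × ℕ) × ℕ => p.1.2 := Primrec.snd.comp Primrec.fst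
    have ha : Primrec fun p : (α × ℕ) × ℕ => p.2 := Primrec.snd
    have hc := primrec_boxCode ha hi
    have hf : Primrec fun p : ((α × ℕ) × ℕ) × ℕ => p.1 := Primrec.fst
    have hs : Primrec fun p : ((α × ℕ) × ℕ) × ℕ => p.2 := Primrec.snd
    have h2 := h1.comp hf
    exact PrimrecPred.forall_lt_fun (Primrec.const 2)
      (PrimrecPred.forall_lt_fun (hn1.comp Primrec.fst)
      (PrimrecPred.imp (Primrec.nat_lt.comp hc (hn1.comp h1))
        (PrimrecPred.iff (primrecPred_bit (ht.comp h1) hc)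
          (PrimrecPred.forall_lt_fun (hN.comp h1)
            (PrimrecPred.imp (primrecPred_bit (hW.comp h2) hs)
              (PrimrecPred.imp (primrecPred_typeRel (hn.comp h2) (hE.comp h2) (hi.comp hf)
                (ht.comp h2) hs) (primrecPred_bit hs (ha.comp hf))))))))
  · exact PrimrecPred.exists_lt_fun hN
      ((primrecPred_bit (hW.comp Primrec.fst) Primrec.snd).and
        ((primrecPred_bit (hE.comp Primrec.fst) Primrec.snd).and
          (primrecPred_typeRel (hn.comp Primrec.fst) (hE.comp Primrec.fst) (Primrec.const 0)
            (ht.comp Primrec.fst) Primrec.snd)))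

/-- All quantifiers, including those over sets of types, are bounded by primitive recursive
functions of `n`. -/
theorem primrecPred_refutable : PrimrecPred Refutable := by
  have hN : Primrec fun n : ℕ => 2 ^ (n + 1) := primrec_two_pow Primrec.succ
  have hNN := primrec_two_pow hN
  have hn : Primrec fun p : (ℕ × ℕ) × ℕ => p.1.1 := Primrec.fst.comp Primrec.fst
  have hW : Primrec fun p : (ℕ × ℕ) × ℕ => p.1.2 := Primrec.snd.comp Primrec.fst
  have hE : Primrec fun p : (ℕ × ℕ) × ℕ => p.2 := Primrec.snd
  have hf : Primrec fun p : ((ℕ × ℕ) × ℕ) × ℕ => p.1 := Primrec.fst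
  have ht : Primrec fun p : ((ℕ × ℕ) × ℕ) × ℕ => p.2 := Primrec.snd
  have hWt := primrecPred_bit (hW.comp hf) ht
  exact PrimrecPred.exists_lt_fun hNN (PrimrecPred.exists_lt_fun (hNN.comp Primrec.fst)
    ((PrimrecPred.forall_lt_fun (hN.comp hn) (PrimrecPred.imp hWt
      (primrecPred_isGoodType (hn.comp hf) (hW.comp hf) (hE.comp hf) ht))).and
    (PrimrecPred.exists_lt_fun (hN.comp hn)
      (hWt.and (primrecPred_bit ht (hn.comp hf)).not))))

end Decidability

theorem isDecidable_logicL : IsDecidable logicL := by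
  refine (primrecPred_refutable.not.of_eq fun n => ?_).computablePred
  obtain ⟨A, rfl⟩ := code_surjective n
  rw [← notMem_logicL_iff, not_not]
  refine ⟨fun h => ⟨A, h, rfl⟩, ?_⟩
  rintro ⟨B, hB, hBA⟩
  rwa [← code_injective hBA]

end Modal

theorem mainTheorem2 :
    Modal.IsFinitelyAxiomatizable Modal.logicL ∧
      Modal.HasFiniteModelProperty Modal.logicL ∧
      Modal.IsDecidable Modal.logicL :=
  ⟨Modal.isFinitelyAxiomatizable_logicL, Modal.hasFiniteModelProperty_logicL,
    Modal.isDecidable_logicL⟩
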